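/- Let $G=(V,E)$ be a finite simple graph with $n=|V|$ vertices. A tree decomposition of $G$ is a finite tree $T$ together with a bag $B_u\subseteq V$ for every node $u$ of $T$, such that both ends of every edge of $G$ lie in a common bag and, for every $x\in V$, the nodes whose bags contain $x$ induce a non-empty subtree of $T$; its size is $\max_u |B_u|-1$, and the treewidth $tw(G)$ is the minimum size of a tree decomposition of $G$. For an integer $k\ge 0$, the $k$-recoloring graph $R_k(G)$ is the graph whose vertices are the proper $k$-colorings $V\to\{1,\dots,k\}$ of $G$, two of them being adjacent when they differ on exactly one vertex of $G$. If $k\ge tw(G)+2$, then $G$ is $k$-mixing, that is, $R_k(G)$ is connected, and the diameter of $R_k(G)$ is at most $2(n^2+n)$. -/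

import Mathlib

/-- A tree decomposition of a graph `G`: a finite tree together with a bag of vertices of `G` at
each node, such that every edge of `G` lies in some bag, and for every vertex `x` of `G` the nodes
whose bags contain `x` induce a non-empty subtree (`SimpleGraph.Connected` includes
non-emptiness). -/
structure TreeDecomposition {V : Type*} (G : SimpleGraph V) where
  /-- The nodes of the tree. -/
  Node : Type
  /-- The tree is finite. -/
  [fintypeNode : Fintype Node]
  /-- The adjacency of the tree. -/
  tree : SimpleGraph Node
  isTree : tree.IsTree
  /-- The bag of a node. -/
  bag : Node → Finset V
  exists_mem_bag_of_adj : ∀ x y : V, G.Adj x y → ∃ u : Node, x ∈ bag u ∧ y ∈ bag u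
  connected_nodes : ∀ x : V, (tree.induce {u : Node | x ∈ bag u}).Connected

attribute [instance] TreeDecomposition.fintypeNode

namespace TreeDecomposition

/-- The size (width) of a tree decomposition: the largest number of vertices in a bag, minus one.
It is an integer, as it equals `-1` when all bags are empty. -/
def width {V : Type*} {G : SimpleGraph V} (T : TreeDecomposition G) : ℤ :=
  ((Finset.univ.sup fun u : T.Node => (T.bag u).card : ℕ) : ℤ) - 1

/-- The tree decomposition with one node, whose bag is the whole vertex set. -/
def trivial {V : Type*} [Fintype V] (G : SimpleGraph V) : TreeDecomposition G where
  Node := Unit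
  tree := ⊥
  isTree := SimpleGraph.IsTree.of_subsingleton
  bag := fun _ => Finset.univ
  exists_mem_bag_of_adj := fun _ _ _ => ⟨(), Finset.mem_univ _, Finset.mem_univ _⟩
  connected_nodes := fun x => by
    have : Nonempty {u : Unit | x ∈ (Finset.univ : Finset V)} := ⟨⟨(), Finset.mem_univ x⟩⟩
    exact SimpleGraph.IsTree.of_subsingleton.connected

end TreeDecomposition

namespace SimpleGraph

/-- The treewidth of a finite graph: the minimum width of a tree decomposition
(the minimum exists, see `SimpleGraph.isLeast_treewidth`). -/
noncomputable def treewidth {V : Type*} (G : SimpleGraph V) : ℤ :=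
  sInf (Set.range fun T : TreeDecomposition G => T.width)

theorem isLeast_treewidth {V : Type*} [Fintype V] (G : SimpleGraph V) :
    IsLeast (Set.range fun T : TreeDecomposition G => T.width) G.treewidth := by
  have hne : (Set.range fun T : TreeDecomposition G => T.width).Nonempty :=
    ⟨_, TreeDecomposition.trivial G, rfl⟩
  have hbdd : BddBelow (Set.range fun T : TreeDecomposition G => T.width) := by
    refine ⟨-1, ?_⟩
    rintro _ ⟨T, rfl⟩
    simp only [TreeDecomposition.width]
    omega
  exact ⟨Int.csInf_mem hne hbdd, fun _ h => csInf_le hbdd h⟩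

/-- The `k`-recoloring graph of `G`: its vertices are the proper `k`-colorings of `G`, and two of
them are adjacent when they differ on exactly one vertex of `G`. -/
def recoloringGraph {V : Type*} (G : SimpleGraph V) (k : ℕ) :
    SimpleGraph (G.Coloring (Fin k)) where
  Adj α β := ∃! v : V, α v ≠ β v
  symm := ⟨fun α β h => by simpa only [ne_comm] using h⟩
  loopless := ⟨fun α h => by
    obtain ⟨v, hv, _⟩ := h
    exact hv rfl⟩

/-- `G` is `k`-mixing when its `k`-recoloring graph is connected. -/
def IsMixing {V : Type*} (G : SimpleGraph V) (k : ℕ) : Prop :=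
  (G.recoloringGraph k).Connected

/-- The `k`-recoloring diameter of `G`: the diameter, in `ℕ∞`, of the `k`-recoloring graph. -/
noncomputable def recoloringDiam {V : Type*} (G : SimpleGraph V) (k : ℕ) : ℕ∞ :=
  (G.recoloringGraph k).ediam

end SimpleGraph

/-! Filling in the bags gives a chordal graph `H ≥ G`. Ordered by depth of highest bags, each vertex
and its earlier neighbors share a bag of at most `k - 1` vertices, so greedy coloring of `H` yields
`γ` avoiding one color. Every coloring `α` is within `n ^ 2 + n` recolorings of `γ`
(`edist_recoloringGraph_le_of_isPerfectOrder`), and two colorings are compared through `γ`.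

To reach `α`, the coloring `δ`, initially `γ`, is corrected one vertex at a time along the order.
With `m` vertices left, fixing the first one, `y`, costs at most `2 * m` recolorings, and these sum
to `n ^ 2 + n`. If `α y` is the color missing near the component of `y`, the class of `δ y` there
takes it, and `δ y` becomes the missing color. Otherwise a Kempe chain at `y` is swapped, with the
missing color as buffer.

Chordality controls both moves: outside neighbors of the component are neighbors of `y`, and the
chain can leave the remaining vertices only through `y`. `H`-edges from `y` to earlier vertices may
then become monochromatic, but only edges meeting the remaining vertices have to stay proper in `H`.
-/

namespace SimpleGraph

/-! ### Recoloring an independent set -/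

section Recoloring

variable {V : Type*} {G : SimpleGraph V} {k : ℕ}

/-- Two colorings whose difference is an independent set are joined by recoloring each vertex on
which they differ once. -/
theorem edist_recoloringGraph_le_card_of_indep (s : Finset V) :
    ∀ f g : G.Coloring (Fin k), (∀ v, f v ≠ g v → v ∈ s) →
      (∀ v w, G.Adj v w → f v ≠ g v → f w = g w) →
      (G.recoloringGraph k).edist f g ≤ (s.card : ℕ∞) := by
  classical
  induction s using Finset.induction_on with
  | empty =>
    intro f g hs _
    have : f = g := DFunLike.ext _ _ fun v => by
      by_contra h
      simpa using hs v h
    simp [this]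
  | insert a s ha ih =>
    intro f g hs hind
    by_cases hfa : f a = g a
    · refine (ih f g (fun v hv => ?_) hind).trans ?_
      · rcases Finset.mem_insert.1 (hs v hv) with rfl | h
        · exact absurd hfa hv
        · exact h
      · exact_mod_cast Finset.card_le_card (Finset.subset_insert a s)
    · let f' : G.Coloring (Fin k) := Coloring.mk (Function.update f a (g a)) (by
        intro v w hvw
        by_cases hv : v = a
        · subst hv
          have hw : w ≠ v := hvw.ne'
          rw [Function.update_self, Function.update_of_ne hw, hind v w hvw hfa]
          exact g.valid hvw
        · by_cases hw : w = a
          · subst hw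
            rw [Function.update_self, Function.update_of_ne hv, hind w v hvw.symm hfa]
            exact g.valid hvw
          · rw [Function.update_of_ne hw, Function.update_of_ne hv]
            exact f.valid hvw)
      have hf' : ∀ v, f' v = Function.update f a (g a) v := fun _ => rfl
      have hne : ∀ v, v ≠ a → f' v = f v := fun v hv => by rw [hf', Function.update_of_ne hv]
      have hself : f' a = g a := by rw [hf', Function.update_self]
      have h1 : (G.recoloringGraph k).edist f f' ≤ 1 := by
        have : (G.recoloringGraph k).Adj f f' := by
          refine ⟨a, fun h => hfa (h.trans hself), fun v hv => ?_⟩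
          by_contra h
          exact hv (hne v h).symm
        exact (edist_eq_one_iff_adj.2 this).le
      have h2 := ih f' g (fun v hv => by
          have hva : v ≠ a := by rintro rfl; exact hv hself
          rw [hne v hva] at hv
          exact (Finset.mem_insert.1 (hs v hv)).resolve_left hva) (fun v w hvw hv => by
          have hva : v ≠ a := by rintro rfl; exact hv hself
          rw [hne v hva] at hv
          by_cases hw : w = a
          · rw [hw, hself]
          · rw [hne w hw]; exact hind v w hvw hv)
      calc (G.recoloringGraph k).edist f g
          ≤ (G.recoloringGraph k).edist f f' + (G.recoloringGraph k).edist f' g := SimpleGraph.edist_triangle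
        _ ≤ 1 + (s.card : ℕ∞) := add_le_add h1 h2
        _ = _ := by rw [Finset.card_insert_of_notMem ha]; push_cast; rw [add_comm]

end Recoloring

/-! ### Components and Kempe chains in a chordal graph -/

section UpReachable

variable {V : Type*} (H : SimpleGraph V) (ord : V → ℕ)

/-- `v` is reached from `y` by a walk of `H` along which `ord` increases and all of whose vertices
after `y` satisfy `Q`. -/
def UpReachable (Q : V → Prop) (y : V) : V → Prop :=
  Relation.ReflTransGen (fun u v => H.Adj u v ∧ ord u < ord v ∧ Q v) y

/-- `ord` orders the vertices of `H` so that the earlier neighbors of each vertex form a clique,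
that is, its reverse is a perfect elimination ordering. -/
structure IsPerfectOrder : Prop where
  injective : Function.Injective ord
  clique : ∀ v a b, H.Adj v a → H.Adj v b → ord a < ord v → ord b < ord v → a ≠ b → H.Adj a b

variable {H ord} {Q : V → Prop} {y : V}

theorem UpReachable.le {v : V} (h : UpReachable H ord Q y v) : ord y ≤ ord v := by
  induction h with
  | refl => exact le_rfl
  | tail _ h ih => exact ih.trans h.2.1.le

theorem UpReachable.prop {v : V} (hy : Q y) (h : UpReachable H ord Q y v) : Q v := by
  cases h with
  | refl => exact hy
  | tail _ h => exact h.2.2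

/-- Adjacency to `w` passes down the walk: the predecessor of `v` and `w` are both earlier neighbors
of `v`, hence adjacent. -/
theorem UpReachable.adj_of_lt (ho : IsPerfectOrder H ord) {v w : V}
    (h : UpReachable H ord Q y v) (hw : ord w < ord y) (hvw : H.Adj v w) : H.Adj y w := by
  induction h with
  | refl => exact hvw
  | @tail u v hu huv ih =>
    have hwu : ord w < ord u := hw.trans_le (UpReachable.le hu)
    exact ih (ho.clique v u w huv.1.symm hvw huv.2.1 (hwu.trans huv.2.1)
      (by rintro rfl; exact hwu.ne rfl))

/-- The vertices reached from `y` are a connected component of those after `y`. -/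
theorem UpReachable.of_adj (ho : IsPerfectOrder H ord) {v w : V}
    (h : UpReachable H ord (fun _ => True) y v) (hw : ord y ≤ ord w) (hvw : H.Adj v w) :
    UpReachable H ord (fun _ => True) y w := by
  induction h with
  | refl =>
    exact .tail .refl ⟨hvw, lt_of_le_of_ne hw fun h => hvw.ne (ho.injective h), trivial⟩
  | @tail u v hu huv ih =>
    rcases lt_or_ge (ord v) (ord w) with h | h
    · exact .tail (.tail hu huv) ⟨hvw, h, trivial⟩
    · have hlt : ord w < ord v := lt_of_le_of_ne h fun h => hvw.ne' (ho.injective h)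
      by_cases huw : u = w
      · exact huw ▸ hu
      · exact ih (ho.clique v u w huv.1.symm hvw huv.2.1 hlt huw)

/-- The vertices colored `p` or `q` reached from `y` form a Kempe chain, up to the edges from `y`
to vertices before it. -/
theorem UpReachable.of_adj_kempe (ho : IsPerfectOrder H ord) {C : Type*} {δ : V → C} {p q : C}
    (hδ : ∀ v w, ord y ≤ ord v → H.Adj v w → δ v ≠ δ w) (hy : δ y = q) {v w : V}
    (h : UpReachable H ord (fun v => δ v = p ∨ δ v = q) y v) (hvw : H.Adj v w)
    (hw : δ w = p ∨ δ w = q) :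
    UpReachable H ord (fun v => δ v = p ∨ δ v = q) y w ∨ (v = y ∧ ord w < ord y) := by
  rcases lt_or_ge (ord v) (ord w) with hlt | hge
  · exact .inl (.tail h ⟨hvw, hlt, hw⟩)
  have hlt : ord w < ord v := lt_of_le_of_ne hge fun h => hvw.ne' (ho.injective h)
  have hv := UpReachable.prop (Q := fun v => δ v = p ∨ δ v = q) (.inr hy) h
  have hyv := UpReachable.le h
  cases h with
  | refl => exact .inr ⟨rfl, hlt⟩
  | @tail u _ hu huv =>
    have hu' := UpReachable.prop (Q := fun v => δ v = p ∨ δ v = q) (.inr hy) hu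
    by_cases huw : u = w
    · exact .inl (huw ▸ hu)
    · have h1 := hδ u w (UpReachable.le hu)
        (ho.clique v u w huv.1.symm hvw huv.2.1 hlt huw)
      have h2 := hδ v w hyv hvw
      have h3 := hδ v u hyv huv.1.symm
      grind

end UpReachable

/-! ### Correcting the target vertex by vertex -/

section Main

variable {V : Type*} {G H : SimpleGraph V} {k : ℕ} {ord : V → ℕ}

/-- Let `L` be an upper set of size `m` of a perfect order of `H ≥ G`, and `δ` a coloring that agrees
with `α` outside `L` and is proper for the edges of `H` that meet `L`. If every connected component
of `H[L]` has a color `r` missing on it and its neighbors in `δ`, then `m ^ 2 + m` recolorings lead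
from `α` to `δ`. -/
theorem edist_recoloringGraph_le_of_isPerfectOrder (ho : IsPerfectOrder H ord) (hGH : G ≤ H)
    (m : ℕ) : ∀ (L : Finset V) (_ : L.card = m) (_ : ∀ v ∈ L, ∀ w, ord v ≤ ord w → w ∈ L)
      (α δ : G.Coloring (Fin k)) (r : V → Fin k)
      (_ : ∀ v, v ∉ L → δ v = α v)
      (_ : ∀ v ∈ L, ∀ w, H.Adj v w → δ v ≠ δ w)
      (_ : ∀ v ∈ L, r v ≠ δ v)
      (_ : ∀ v ∈ L, ∀ w, H.Adj v w → r v ≠ δ w)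
      (_ : ∀ v ∈ L, ∀ w ∈ L, H.Adj v w → r v = r w),
      (G.recoloringGraph k).edist α δ ≤ ((m * m + m : ℕ) : ℕ∞) := by
  classical
  induction m with
  | zero =>
    intro L hL _ α δ r hU _ _ _ _
    have : α = δ := DFunLike.ext _ _ fun v => by
      rw [hU v]
      simp [Finset.card_eq_zero.1 hL]
    simp [this]
  | succ m ih =>
    intro L hL hup α δ r hU hδ hr0 hr1 hr2
    obtain ⟨y, hyL, hmin⟩ := L.exists_min_image ord (Finset.card_pos.1 (by omega))
    have hLiff : ∀ v, v ∈ L ↔ ord y ≤ ord v := fun v => ⟨hmin v, hup y hyL v⟩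
    have hcard : (L.erase y).card = m := by rw [Finset.card_erase_of_mem hyL, hL]; rfl
    have hup' : ∀ v ∈ L.erase y, ∀ w, ord v ≤ ord w → w ∈ L.erase y := by
      intro v hv w hvw
      rw [Finset.mem_erase, hLiff] at hv ⊢
      refine ⟨?_, hv.2.trans hvw⟩
      rintro rfl
      exact hv.1 (ho.injective (le_antisymm hvw hv.2))
    -- it suffices to find an intermediate coloring that agrees with `α` on `y`
    suffices hmid : ∃ (δ' : G.Coloring (Fin k)) (r' : V → Fin k),
        (∀ v, v ∉ L.erase y → δ' v = α v) ∧
        (∀ v ∈ L.erase y, ∀ w, H.Adj v w → δ' v ≠ δ' w) ∧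
        (∀ v ∈ L.erase y, r' v ≠ δ' v) ∧
        (∀ v ∈ L.erase y, ∀ w, H.Adj v w → r' v ≠ δ' w) ∧
        (∀ v ∈ L.erase y, ∀ w ∈ L.erase y, H.Adj v w → r' v = r' w) ∧
        (G.recoloringGraph k).edist δ' δ ≤ ((2 * (m + 1) : ℕ) : ℕ∞) by
      obtain ⟨δ', r', h1, h2, h3, h4, h5, h6⟩ := hmid
      calc (G.recoloringGraph k).edist α δ
          ≤ (G.recoloringGraph k).edist α δ' + (G.recoloringGraph k).edist δ' δ := SimpleGraph.edist_triangle
        _ ≤ ((m * m + m : ℕ) : ℕ∞) + ((2 * (m + 1) : ℕ) : ℕ∞) :=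
          add_le_add (ih (L.erase y) hcard hup' α δ' r' h1 h2 h3 h4 h5) h6
        _ = _ := by norm_cast; ring
    have hmemE : ∀ v, v ∈ L.erase y → v ∈ L := fun v => Finset.mem_of_mem_erase
    have hnE : ∀ v, v ∉ L.erase y → v = y ∨ (v ≠ y ∧ v ∉ L) := by
      intro v hv
      rw [Finset.mem_erase] at hv
      tauto
    have hlt : ∀ w, w ∉ L → ord w < ord y := fun w hw => by
      rw [hLiff] at hw
      exact not_le.1 hw
    by_cases hpq : α y = δ y
    · refine ⟨δ, r, fun v hv => ?_, fun v hv => hδ v (hmemE v hv), fun v hv => hr0 v (hmemE v hv),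
        fun v hv => hr1 v (hmemE v hv), fun v hv w hw => hr2 v (hmemE v hv) w (hmemE w hw), by simp⟩
      rcases hnE v hv with rfl | h
      · exact hpq.symm
      · exact hU v h.2
    by_cases hpr : α y = r y
    · -- recolor the class of `δ y` in the component of `y` with the missing color `α y`
      set S : V → Prop := UpReachable H ord (fun _ => True) y with hS
      have hSy : S y := .refl
      have hSL : ∀ v, S v → v ∈ L := fun v hv => (hLiff v).2 hv.le
      have hScl : ∀ v w, S v → w ∈ L → H.Adj v w → S w := fun v w hv hw hvw =>
        hv.of_adj ho ((hLiff w).1 hw) hvw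
      have hSU : ∀ v w, S v → w ∉ L → H.Adj v w → H.Adj y w := fun v w hv hw hvw =>
        hv.adj_of_lt ho (hlt w hw) hvw
      have hrS : ∀ v, S v → r v = α y := by
        intro v hv
        induction hv with
        | refl => exact hpr.symm
        | @tail u v hu huv ihu =>
          rw [← ihu]
          exact (hr2 u (hSL u hu) v (hSL v (.tail hu huv)) huv.1).symm
      let f : V → Fin k := fun v => if S v ∧ δ v = δ y then α y else δ v
      have hfv : ∀ v w, v ∈ L → H.Adj v w → f v ≠ f w := by
        intro v w hv hvw
        have h1 := hδ v hv w hvw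
        have h2 := hr1 v hv w hvw
        simp only [f]
        by_cases hw : w ∈ L
        · have h3 := hr1 w hw v hvw.symm
          have h4 := hrS v
          have h5 := hrS w
          grind
        · have h4 := hrS v
          have h5 := hSL w
          grind
      let δ' : G.Coloring (Fin k) := Coloring.mk f (by
        intro v w hvw
        by_cases hv : v ∈ L
        · exact hfv v w hv (hGH hvw)
        by_cases hw : w ∈ L
        · exact (hfv w v hw (hGH hvw.symm)).symm
        have hv' : ¬ S v := fun h => hv (hSL v h)
        have hw' : ¬ S w := fun h => hw (hSL w h)
        simpa [f, hv', hw'] using δ.valid hvw)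
      have hδ' : ∀ v, δ' v = f v := fun _ => rfl
      -- The color `δ y` is now free on the component; it is also absent from the neighbors outside
      -- `L`, as these are `H`-neighbors of `y`.
      refine ⟨δ', fun v => if S v then δ y else r v, ?_, ?_, ?_, ?_, ?_, ?_⟩
      · intro v hv
        rw [hδ']
        rcases hnE v hv with rfl | ⟨_, h⟩
        · simp [f, hSy]
        · have hv' : ¬ S v := fun h' => h (hSL v h')
          simpa [f, hv'] using hU v h
      · exact fun v hv w hvw => hfv v w (hmemE v hv) hvw
      · intro v hv
        have h0 := hr0 v (hmemE v hv)
        rw [hδ']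
        simp only [f]
        grind
      · intro v hv w hvw
        have hvL := hmemE v hv
        have h0 := hr1 v hvL w hvw
        have h1 := hδ y hyL w
        have h2 := hScl v w
        have h3 := hSU v w
        have h4 := hScl w v
        have h5 := hvw.symm
        rw [hδ']
        simp only [f]
        grind
      · intro v hv w hw hvw
        have h1 := hScl v w
        have h2 := hScl w v
        have h3 := hvw.symm
        have h4 := hr2 v (hmemE v hv) w (hmemE w hw) hvw
        have h5 := hmemE v hv
        have h6 := hmemE w hw
        grind
      · refine (edist_recoloringGraph_le_card_of_indep L δ' δ ?_ ?_).trans ?_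
        · intro v hv
          by_contra h
          have hv' : ¬ S v := fun h' => h (hSL v h')
          exact hv (by simp [hδ', f, hv'])
        · intro v w hvw hv
          have h1 := δ.valid hvw
          simp only [hδ', f] at hv ⊢
          grind
        · rw [hL]
          exact_mod_cast (by omega)
    · -- swap the colors on the Kempe chain of `y`
      set M : V → Prop := UpReachable H ord (fun v => δ v = α y ∨ δ v = δ y) y with hM
      have hMy : M y := .refl
      have hML : ∀ v, M v → v ∈ L := fun v hv => (hLiff v).2 hv.le
      have hMc : ∀ v, M v → δ v = α y ∨ δ v = δ y := fun v hv =>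
        UpReachable.prop (Q := fun v => δ v = α y ∨ δ v = δ y) (.inr rfl) hv
      have hMcl : ∀ v w, M v → H.Adj v w → (δ w = α y ∨ δ w = δ y) → M w ∨ (v = y ∧ w ∉ L) := by
        intro v w hv hvw hw
        refine (hv.of_adj_kempe ho (fun v w h => hδ v ((hLiff v).2 h) w) rfl hvw hw).imp_right ?_
        rintro ⟨h1, h2⟩
        exact ⟨h1, fun h => h2.not_ge ((hLiff w).1 h)⟩
      have hrM : ∀ v, M v → r v = r y := by
        intro v hv
        induction hv with
        | refl => rfl
        | @tail u v hu huv ihu =>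
          rw [← ihu]
          exact (hr2 u (hML u hu) v (hML v (.tail hu huv)) huv.1).symm
      have hry := hr0 y hyL
      -- The two classes of the chain are given colors `a` and `b`; this covers the swap and its
      -- intermediate stages.
      let f : Fin k → Fin k → V → Fin k := fun a b v =>
        if M v then (if δ v = δ y then a else b) else δ v
      have hMedge : ∀ (a b : Fin k), a ≠ b → (a = α y ∨ a = δ y ∨ a = r y) →
          (b = α y ∨ b = δ y ∨ b = r y) → ∀ v w, M v → H.Adj v w → (v = y → w ∈ L) →
          f a b v ≠ f a b w := by
        intro a b hab ha hb v w hv hvw hvy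
        have h1 := hδ v (hML v hv) w hvw
        have h2 := hr1 v (hML v hv) w hvw
        have h3 := hrM v hv
        have h4 := hMc v hv
        have h5 := hMcl v w hv hvw
        have h6 := hMc w
        simp only [f]
        grind
      have hHedge : ∀ (a b : Fin k), a ≠ b → (a = α y ∨ a = δ y ∨ a = r y) →
          (b = α y ∨ b = δ y ∨ b = r y) → ∀ v w, v ∈ L → H.Adj v w → (v = y → w ∈ L) →
          f a b v ≠ f a b w := by
        intro a b hab ha hb v w hv hvw hvy
        by_cases hMv : M v
        · exact hMedge a b hab ha hb v w hMv hvw hvy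
        by_cases hMw : M w
        · exact (hMedge a b hab ha hb w v hMw hvw.symm fun _ => hv).symm
        simpa [f, hMv, hMw] using hδ v hv w hvw
      have hGedge : ∀ (a b : Fin k), a ≠ b → (a = α y ∨ a = δ y ∨ a = r y) →
          (b = α y ∨ b = δ y ∨ b = r y) → ∀ v w, v ∈ L → G.Adj v w → f a b v ≠ f a b w := by
        intro a b hab ha hb v w hv hvw
        by_cases hvy : v = y → w ∈ L
        · exact hHedge a b hab ha hb v w hv (hGH hvw) hvy
        push Not at hvy
        -- On a `G`-edge leaving `L` from `y`, the color `α y` is safe because `δ` agrees with `α`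
        -- at the other end.
        obtain ⟨rfl, hw⟩ := hvy
        have h1 := hU w hw
        have h2 := α.valid hvw
        have h3 := δ.valid hvw
        have h4 := hr1 v hv w (hGH hvw)
        have h5 := hML w
        simp only [f]
        grind
      have hproper : ∀ (a b : Fin k), a ≠ b → (a = α y ∨ a = δ y ∨ a = r y) →
          (b = α y ∨ b = δ y ∨ b = r y) → ∀ v w, G.Adj v w → f a b v ≠ f a b w := by
        intro a b hab ha hb v w hvw
        by_cases hv : v ∈ L
        · exact hGedge a b hab ha hb v w hv hvw
        by_cases hw : w ∈ L
        · exact (hGedge a b hab ha hb w v hw hvw.symm).symm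
        have hv' : ¬ M v := fun h => hv (hML v h)
        have hw' : ¬ M w := fun h => hw (hML w h)
        simpa [f, hv', hw'] using δ.valid hvw
      let δ' : G.Coloring (Fin k) := Coloring.mk (f (α y) (δ y))
        (fun {v w} => hproper _ _ hpq (by simp) (by simp) v w)
      let f₁ : G.Coloring (Fin k) := Coloring.mk (f (r y) (δ y))
        (fun {v w} => hproper _ _ hry (by simp) (by simp) v w)
      let f₂ : G.Coloring (Fin k) := Coloring.mk (f (r y) (α y))
        (fun {v w} => hproper _ _ (Ne.symm hpr) (by simp) (by simp) v w)
      have hδ' : ∀ v, δ' v = f (α y) (δ y) v := fun _ => rfl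
      have hf₁ : ∀ v, f₁ v = f (r y) (δ y) v := fun _ => rfl
      have hf₂ : ∀ v, f₂ v = f (r y) (α y) v := fun _ => rfl
      refine ⟨δ', r, ?_, ?_, ?_, ?_, ?_, ?_⟩
      · intro v hv
        rw [hδ']
        rcases hnE v hv with rfl | ⟨_, h⟩
        · simp [f, hMy]
        · have hv' : ¬ M v := fun h' => h (hML v h')
          simpa [f, hv'] using hU v h
      · exact fun v hv w hvw => hHedge _ _ hpq (by simp) (by simp) v w (hmemE v hv) hvw
          fun h => absurd h (Finset.ne_of_mem_erase hv)
      · intro v hv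
        have h0 := hr0 v (hmemE v hv)
        have h1 := hrM v
        rw [hδ']
        simp only [f]
        grind
      · intro v hv w hvw
        have h0 := hr1 v (hmemE v hv) w hvw
        have h1 := hrM w
        have h2 := hML w
        have h3 := hr2 v (hmemE v hv) w
        rw [hδ']
        simp only [f]
        grind
      · exact fun v hv w hw => hr2 v (hmemE v hv) w (hmemE w hw)
      -- One class moves to the buffer `r y`, the other to `α y`, then the first to `δ y`. The first
      -- two moves touch disjoint parts of `L`, so all three cost at most `2 * L.card`.
      · have e1 := edist_recoloringGraph_le_card_of_indep (L.filter fun v => δ v = δ y) δ' f₁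
          (by
            intro v hv
            have := hML v
            simp only [hδ', hf₁, f] at hv
            simp only [Finset.mem_filter]
            grind)
          (by
            intro v w hvw hv
            have := δ.valid hvw
            simp only [hδ', hf₁, f] at hv ⊢
            grind)
        have e2 := edist_recoloringGraph_le_card_of_indep (L.filter fun v => ¬ δ v = δ y) f₁ f₂
          (by
            intro v hv
            have := hML v
            simp only [hf₂, hf₁, f] at hv
            simp only [Finset.mem_filter]
            grind)
          (by
            intro v w hvw hv
            have := δ.valid hvw
            have := hMc v
            have := hMc w
            simp only [hf₂, hf₁, f] at hv ⊢
            grind)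
        have e3 := edist_recoloringGraph_le_card_of_indep L f₂ δ
          (by
            intro v hv
            have := hML v
            simp only [hf₂, f] at hv
            grind)
          (by
            intro v w hvw hv
            have := δ.valid hvw
            have := hMc v
            have := hMc w
            simp only [hf₂, f] at hv ⊢
            grind)
        have hc := L.card_filter_add_card_filter_not (fun v => δ v = δ y)
        calc (G.recoloringGraph k).edist δ' δ
            ≤ (G.recoloringGraph k).edist δ' f₁ + ((G.recoloringGraph k).edist f₁ f₂
                + (G.recoloringGraph k).edist f₂ δ) :=
              SimpleGraph.edist_triangle.trans (add_le_add le_rfl SimpleGraph.edist_triangle)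
          _ ≤ _ := add_le_add e1 (add_le_add e2 e3)
          _ ≤ _ := by norm_cast; omega

end Main

/-! ### Greedy coloring with a spare color -/

section Greedy

variable {V : Type*} [Fintype V] {H : SimpleGraph V} {ord : V → ℕ}

/-- Greedy coloring along an ordering in which each vertex, together with its earlier neighbors,
lies in a set of fewer than `k` elements; one color `c` is not used. -/
theorem exists_coloring_of_earlier_neighbors (hinj : Function.Injective ord) {k : ℕ} (c : Fin k)
    (hd : ∀ v, ∃ B : Finset V, v ∈ B ∧ (∀ w, H.Adj v w → ord w < ord v → w ∈ B) ∧ B.card + 1 ≤ k) :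
    ∃ γ : H.Coloring (Fin k), ∀ v, γ v ≠ c := by
  classical
  have key : ∀ m : ℕ, ∃ γ : V → Fin k, (∀ v, ord v < m → γ v ≠ c) ∧
      ∀ v w, ord v < m → ord w < m → H.Adj v w → γ v ≠ γ w := by
    intro m
    induction m with
    | zero => exact ⟨fun _ => c, by simp, by simp⟩
    | succ m ih =>
      obtain ⟨γ, h1, h2⟩ := ih
      by_cases hm : ∃ v, ord v = m
      · obtain ⟨v, hv⟩ := hm
        obtain ⟨B, hvB, hB, hcard⟩ := hd v
        obtain ⟨a, ha⟩ : ∃ a, a ∉ insert c ((B.erase v).image γ) := by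
          by_contra! h
          have h3 : (insert c ((B.erase v).image γ)).card = k := by
            rw [Finset.eq_univ_of_forall h, Finset.card_univ, Fintype.card_fin]
          have h4 := Finset.card_insert_le c ((B.erase v).image γ)
          have h5 := Finset.card_image_le (s := B.erase v) (f := γ)
          rw [Finset.card_erase_of_mem hvB] at h5
          have := Finset.card_pos.2 ⟨v, hvB⟩
          omega
        simp only [Finset.mem_insert, Finset.mem_image, not_or, not_exists, not_and] at ha
        have hlt : ∀ w, w ≠ v → ord w < m + 1 → ord w < m := fun w hw h => by
          have : ord w ≠ ord v := fun h => hw (hinj h)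
          omega
        have hnb : ∀ w, H.Adj v w → ord w < m + 1 → γ w ≠ a := fun w hw h => by
          refine ha.2 w (Finset.mem_erase.2 ⟨hw.ne', hB w hw ?_⟩)
          rw [hv]
          exact hlt w hw.ne' h
        refine ⟨Function.update γ v a, fun w hw => ?_, fun w x hw hx hwx => ?_⟩
        · by_cases hwv : w = v
          · rw [hwv, Function.update_self]; exact ha.1
          · rw [Function.update_of_ne hwv]; exact h1 w (hlt w hwv hw)
        · by_cases hwv : w = v
          · subst hwv
            rw [Function.update_self, Function.update_of_ne hwx.ne']
            exact (hnb x hwx hx).symm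
          · by_cases hxv : x = v
            · subst hxv
              rw [Function.update_self, Function.update_of_ne hwv]
              exact hnb w hwx.symm hw
            · rw [Function.update_of_ne hwv, Function.update_of_ne hxv]
              exact h2 w x (hlt w hwv hw) (hlt x hxv hx) hwx
      · push Not at hm
        exact ⟨γ, fun v hv => h1 v (by have := hm v; omega),
          fun v w hv hw => h2 v w (by have := hm v; omega) (by have := hm w; omega)⟩
  obtain ⟨γ, h1, h2⟩ := key (Finset.univ.sup ord + 1)
  have hlt : ∀ v, ord v < Finset.univ.sup ord + 1 := fun v =>
    Nat.lt_succ_of_le (Finset.le_sup (Finset.mem_univ v))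
  exact ⟨Coloring.mk γ fun {v w} => h2 v w (hlt v) (hlt w), fun v => h1 v (hlt v)⟩

end Greedy

/-! ### Subtrees of a rooted tree -/

section RootedTree

variable {N : Type*} {T : SimpleGraph N}

/-- In a tree rooted at `ρ`, `b` is the parent of `a`. -/
def IsParent (T : SimpleGraph N) (ρ a b : N) : Prop :=
  T.Adj a b ∧ T.dist ρ a = T.dist ρ b + 1

/-- Shortest walks from `ρ` to two parents both extend to paths ending at `a`, and such a path is
unique. -/
theorem IsTree.isParent_unique (hT : T.IsTree) {ρ a b c : N} (hb : T.IsParent ρ a b)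
    (hc : T.IsParent ρ a c) : b = c := by
  obtain ⟨p, hp⟩ := hT.connected.exists_walk_length_eq_dist ρ b
  obtain ⟨q, hq⟩ := hT.connected.exists_walk_length_eq_dist ρ c
  have h1 : (p.concat hb.1.symm).IsPath := Walk.isPath_of_length_eq_dist _ (by
    rw [Walk.length_concat, hp, hb.2])
  have h2 : (q.concat hc.1.symm).IsPath := Walk.isPath_of_length_eq_dist _ (by
    rw [Walk.length_concat, hq, hc.2])
  have h3 := congrArg Walk.penultimate ((hT.existsUnique_path ρ a).unique h1 h2)
  simpa using h3

theorem IsTree.isParent_or_isParent (hT : T.IsTree) (ρ : N) {a b : N} (h : T.Adj a b) :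
    T.IsParent ρ a b ∨ T.IsParent ρ b a := by
  rcases hT.dist_eq_dist_add_one_of_adj ρ h with h1 | h1
  · exact .inl ⟨h, h1⟩
  · exact .inr ⟨h.symm, h1⟩

theorem eq_or_dist_lt_of_isParent {ρ u s : N} (h : Relation.ReflTransGen (T.IsParent ρ) s u) :
    s = u ∨ T.dist ρ u < T.dist ρ s := by
  induction h with
  | refl => exact .inl rfl
  | tail _ h ih =>
    have := h.2
    rcases ih with rfl | ih
    · right; omega
    · right; omega

/-- A subtree that does not contain the parent of its node `u` hangs below `u`. -/
theorem IsTree.descendant_of_isParent_notMem (hT : T.IsTree) {ρ u s : N} {S : Set N}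
    (hS : (T.induce S).Connected) (hu : u ∈ S) (hpar : ∀ b, T.IsParent ρ u b → b ∉ S)
    (hs : s ∈ S) : Relation.ReflTransGen (T.IsParent ρ) s u := by
  have h := (reachable_iff_reflTransGen _ _).1 (hS.preconnected ⟨u, hu⟩ ⟨s, hs⟩)
  suffices ∀ x : S, Relation.ReflTransGen (T.induce S).Adj ⟨u, hu⟩ x →
      Relation.ReflTransGen (T.IsParent ρ) x.1 u from this _ h
  intro x hx
  induction hx with
  | refl => exact .refl
  | @tail x z _ hxz ih =>
    have hadj : T.Adj x.1 z.1 := hxz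
    rcases hT.isParent_or_isParent ρ hadj with h | h
    · rcases Relation.ReflTransGen.cases_head ih with h' | ⟨c, hc, hcu⟩
      · exact absurd z.2 (hpar z.1 (h' ▸ h))
      · exact hT.isParent_unique hc h ▸ hcu
    · exact .head h ih

/-- Two subtrees that meet both contain the highest node of the one that starts lower. -/
theorem IsTree.exists_mem_inter_minimal (hT : T.IsTree) {ρ s t u : N} {A B : Set N}
    (hA : (T.induce A).Connected) (hB : (T.induce B).Connected)
    (hs : s ∈ A) (ht : t ∈ B) (htmin : ∀ b ∈ B, T.dist ρ t ≤ T.dist ρ b)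
    (hst : T.dist ρ s ≤ T.dist ρ t) (huA : u ∈ A) (huB : u ∈ B) : t ∈ A := by
  induction hn : T.dist ρ u using Nat.strong_induction_on generalizing u with
  | _ n ih =>
    by_cases hparB : ∀ b, T.IsParent ρ u b → b ∉ B
    · rcases eq_or_dist_lt_of_isParent (hT.descendant_of_isParent_notMem hB huB hparB ht) with h | h
      · exact h ▸ huA
      · exact absurd (htmin u huB) (not_le.2 h)
    by_cases hparA : ∀ b, T.IsParent ρ u b → b ∉ A
    · push Not at hparB
      obtain ⟨b, hb, hbB⟩ := hparB
      have h1 := htmin b hbB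
      have h2 := hb.2
      rcases eq_or_dist_lt_of_isParent (hT.descendant_of_isParent_notMem hA huA hparA hs) with rfl | h
      · omega
      · omega
    push Not at hparA hparB
    obtain ⟨b, hb, hbB⟩ := hparB
    obtain ⟨c, hc, hcA⟩ := hparA
    have hbc := hT.isParent_unique hc hb
    subst hbc
    exact ih (T.dist ρ c) (by have := hb.2; omega) hcA hbB rfl

end RootedTree

end SimpleGraph

/-! ### Perfect order from a tree decomposition -/

namespace TreeDecomposition

open SimpleGraph

variable {V : Type*} {G : SimpleGraph V}

/-- The chordal graph in which two vertices are adjacent when they share a bag. -/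
def bagGraph (T : TreeDecomposition G) : SimpleGraph V where
  Adj x y := x ≠ y ∧ ∃ u, x ∈ T.bag u ∧ y ∈ T.bag u
  symm := ⟨fun _ _ h => ⟨h.1.symm, h.2.imp fun _ h => h.symm⟩⟩
  loopless := ⟨fun _ h => h.1 rfl⟩

theorem le_bagGraph (T : TreeDecomposition G) : G ≤ T.bagGraph :=
  fun x y h => ⟨h.ne, T.exists_mem_bag_of_adj x y h⟩

theorem exists_ord_top [Fintype V] (T : TreeDecomposition G) :
    ∃ (ord : V → ℕ) (top : V → T.Node), Function.Injective ord ∧ (∀ v, v ∈ T.bag (top v)) ∧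
      ∀ v w, T.bagGraph.Adj v w → ord w < ord v → w ∈ T.bag (top v) := by
  have ρ : T.Node := T.isTree.connected.nonempty.some
  have htop : ∀ v, ∃ t, v ∈ T.bag t ∧ ∀ b, v ∈ T.bag b → T.tree.dist ρ t ≤ T.tree.dist ρ b := by
    intro v
    obtain ⟨t, ht⟩ := (T.connected_nodes v).nonempty
    obtain ⟨t, ht, hmin⟩ := Set.exists_min_image {u | v ∈ T.bag u} (T.tree.dist ρ)
      (Set.toFinite _) ⟨t, ht⟩
    exact ⟨t, ht, hmin⟩
  choose top htop hmin using htop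
  let e := Fintype.equivFin V
  -- Lexicographic order: depth of the highest bag first, ties broken by `e v < Fintype.card V`.
  refine ⟨fun v => T.tree.dist ρ (top v) * Fintype.card V + e v, top, ?_, htop, ?_⟩
  · intro v w h
    have h1 := congrArg (· % Fintype.card V) h
    simp only [Nat.mul_add_mod_self_right, Nat.mod_eq_of_lt (e _).2] at h1
    exact e.injective (Fin.ext h1)
  · rintro v w ⟨_, u, huv, huw⟩ hlt
    refine T.isTree.exists_mem_inter_minimal (T.connected_nodes w) (T.connected_nodes v)
      (htop w) (htop v) (hmin v) ?_ huw huv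
    by_contra! h
    have h1 := Nat.mul_le_mul_right (Fintype.card V) (Nat.succ_le_of_lt h)
    rw [Nat.succ_mul] at h1
    have h2 := (e v).2
    simp only at hlt
    omega

end TreeDecomposition

theorem theorem2 {V : Type*} [Fintype V] (G : SimpleGraph V) (k : ℕ)
    (hk : G.treewidth + 2 ≤ (k : ℤ)) :
    G.IsMixing k ∧
      G.recoloringDiam k ≤ ((2 * (Fintype.card V ^ 2 + Fintype.card V) : ℕ) : ℕ∞) := by
  classical
  obtain ⟨T, hT⟩ := G.isLeast_treewidth.1
  obtain ⟨ord, top, hinj, htop, hback⟩ := T.exists_ord_top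
  have hwidth : ∀ u, (T.bag u).card + 1 ≤ k := by
    intro u
    have h1 := Finset.le_sup (f := fun u => (T.bag u).card) (Finset.mem_univ u)
    simp only [TreeDecomposition.width] at hT h1
    omega
  have hkpos : 0 < k := by
    have := hwidth T.isTree.connected.nonempty.some
    omega
  have ho : T.bagGraph.IsPerfectOrder ord :=
    ⟨hinj, fun v a b ha hb hav hbv hab => ⟨hab, top v, hback v a ha hav, hback v b hb hbv⟩⟩
  obtain ⟨γ, hγ⟩ := SimpleGraph.exists_coloring_of_earlier_neighbors hinj (H := T.bagGraph)
    (⟨0, hkpos⟩ : Fin k) fun v => ⟨T.bag (top v), htop v, hback v, hwidth _⟩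
  let γ' : G.Coloring (Fin k) := SimpleGraph.Coloring.mk γ fun h => γ.valid (T.le_bagGraph h)
  have hdist : ∀ α, (G.recoloringGraph k).edist α γ' ≤
      ((Fintype.card V * Fintype.card V + Fintype.card V : ℕ) : ℕ∞) := fun α =>
    SimpleGraph.edist_recoloringGraph_le_of_isPerfectOrder ho T.le_bagGraph _ Finset.univ
      -- Color `0`, avoided by `γ`, is the missing color everywhere.
      rfl (by simp) α γ' (fun _ => ⟨0, hkpos⟩) (by simp) (fun v _ w h => γ.valid h)
      (fun v _ => (hγ v).symm) (fun v _ w _ => (hγ w).symm) (by simp)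
  have hdist₂ : ∀ α β, (G.recoloringGraph k).edist α β ≤
      ((2 * (Fintype.card V ^ 2 + Fintype.card V) : ℕ) : ℕ∞) := by
    intro α β
    have hβ := hdist β
    rw [SimpleGraph.edist_comm] at hβ
    calc (G.recoloringGraph k).edist α β
        ≤ (G.recoloringGraph k).edist α γ' + (G.recoloringGraph k).edist γ' β :=
          SimpleGraph.edist_triangle
      _ ≤ _ := add_le_add (hdist α) hβ
      _ = _ := by norm_cast; ring
  refine ⟨?_, SimpleGraph.ediam_le_of_edist_le hdist₂⟩
  have : Nonempty (G.Coloring (Fin k)) := ⟨γ'⟩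
  exact ⟨fun α β => SimpleGraph.reachable_of_edist_ne_top
    (ne_top_of_le_ne_top (ENat.natCast_ne_top _) (hdist₂ α β))⟩
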